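/- Let $M$ be a finite-dimensional $C^1$ manifold without boundary (Hausdorff and second countable, not necessarily compact), and let $C^1(M,M)$ be the space of $C^1$ maps from $M$ to itself. For a set $A\subseteq M$ that is forward invariant under $F$ (i.e. $F(A)\subseteq A$), call $A$ transitive if for any two open sets $U,V\subseteq M$ that meet $A$ there are $n\ge 0$ and $x\in A\cap U$ with $F^n(x)\in V$. Then for a generic $F\in C^1(M,M)$ the following holds: every transitive closed forward-invariant set $A$ of $F$ with nonempty interior coincides with the closure of its interior, $A=\overline{\operatorname{Int} A}$. Here "generic" means that the set of all $F$ with this property is residual (contains a countable intersection of open dense sets) in $C^1(M,M)$, and this is true both for the weak $C^1$ topology (uniform convergence of maps and first derivatives on compact sets) and for the strong (Whitney) $C^1$ topology. (When $M$ is compact the two topologies coincide.) -/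

import Mathlib

open scoped Manifold ContDiff Topology

/-- The space of `C^1` self-maps of a manifold `M` modelled on `E`. -/
abbrev C1SelfMap (E : Type*) [NormedAddCommGroup E] [NormedSpace ℝ E]
    (M : Type*) [TopologicalSpace M] [ChartedSpace E M] : Type _ :=
  ContMDiffMap 𝓘(ℝ, E) 𝓘(ℝ, E) M M 1

namespace C1SelfMap

variable {E : Type*} [NormedAddCommGroup E] [NormedSpace ℝ E]
  {M : Type*} [TopologicalSpace M] [ChartedSpace E M]

/-- Chart data `(φ, ψ, K, ε)` adapted to `f`: `φ`, `ψ` are `C^1` charts of `M`, `K` is a compact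
subset of the domain of `φ` with `f(K)` contained in the domain of `ψ`, and `ε > 0`. -/
structure IsAdapted (f : C1SelfMap E M) (φ ψ : OpenPartialHomeomorph M E) (K : Set M) (ε : ℝ) :
    Prop where
  source_chart : φ ∈ IsManifold.maximalAtlas 𝓘(ℝ, E) 1 M
  target_chart : ψ ∈ IsManifold.maximalAtlas 𝓘(ℝ, E) 1 M
  isCompact : IsCompact K
  subset_source : K ⊆ φ.source
  mapsTo : Set.MapsTo f K ψ.source
  pos : 0 < ε

/-- The maps `g` that are `ε`-close to `f` on `K` together with their first derivatives, as read in
the charts `φ` and `ψ`. -/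
def chartNhd (f : C1SelfMap E M) (φ ψ : OpenPartialHomeomorph M E) (K : Set M) (ε : ℝ) :
    Set (C1SelfMap E M) :=
  {g | Set.MapsTo g K ψ.source ∧ ∀ x ∈ K,
    ‖ψ (g x) - ψ (f x)‖ < ε ∧
    ‖fderiv ℝ (fun v => ψ (g (φ.symm v))) (φ x) - fderiv ℝ (fun v => ψ (f (φ.symm v))) (φ x)‖ < ε}

variable (E M)

/-- The weak (compact-open) `C^1` topology: uniform convergence of the maps and of their first
derivatives on compact sets. -/
abbrev weakTopology : TopologicalSpace (C1SelfMap E M) :=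
  TopologicalSpace.generateFrom
    {N | ∃ f φ ψ K ε, IsAdapted f φ ψ K ε ∧ N = chartNhd f φ ψ K ε}

/-- The strong (Whitney) `C^1` topology: a basic open set prescribes closeness simultaneously for a
family of chart data whose source charts are locally finite. (Such families are countable up to
empty charts when `M` is second countable, so index types in `Type` suffice.) -/
abbrev strongTopology : TopologicalSpace (C1SelfMap E M) :=
  TopologicalSpace.generateFrom
    {N | ∃ (f : C1SelfMap E M) (ι : Type) (φ ψ : ι → OpenPartialHomeomorph M E) (K : ι → Set M)
      (ε : ι → ℝ), LocallyFinite (fun i => (φ i).source) ∧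
      (∀ i, IsAdapted f (φ i) (ψ i) (K i) (ε i)) ∧
      N = ⋂ i, chartNhd f (φ i) (ψ i) (K i) (ε i)}

end C1SelfMap

/-- Topological transitivity of `f` on an invariant set `A`: for any two nonempty relatively open
subsets of `A`, some iterate of `f` takes a point of the first one into the second one. -/
def IsTransitiveSet {X : Type*} [TopologicalSpace X] (f : X → X) (A : Set X) : Prop :=
  ∀ U V : Set X, IsOpen U → IsOpen V → (A ∩ U).Nonempty → (A ∩ V).Nonempty →
    ∃ n : ℕ, (A ∩ U ∩ f^[n] ⁻¹' V).Nonempty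

/-- Every transitive closed forward-invariant set of `f` with nonempty interior is the closure of
its interior. -/
def TransitiveSetsAreRegularClosed {X : Type*} [TopologicalSpace X] (f : X → X) : Prop :=
  ∀ A : Set X, IsClosed A → Set.MapsTo f A A → IsTransitiveSet f A → (interior A).Nonempty →
    A = closure (interior A)

/-!
A map `f` for which the image of every nonempty open set has nonempty interior has the required
property: given `x` in a transitive set `A` and an open `V` containing `x`, some iterate `f^[n]`
sends a point of `interior A` into `V`, hence sends a whole open subset `W` of `interior A` into
`V ∩ A`; as `f^[n] '' W` has interior, `V` meets `interior A`
(`transitiveSetsAreRegularClosed_of_interior_image`).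

By the inverse function theorem this applies to every `C^1` map whose regular points (those with
invertible derivative) are dense, that is, to every map with a regular point in each member of a
countable base of `M`. For a fixed nonempty open `B`, the maps with a regular point in `B` form a set

* open in both topologies, since invertible operators form an open set
  (`C1SelfMap.HasRegularPointIn.exists_chartNhd_subset`);
* dense in both topologies: for `x₀` in `B`, adding in charts a cut-off multiple `t • (v - v₀)` of
  the radial field to `F` changes the derivative `L` at `x₀` to `L + t • 1`, which is invertible for
  all small `t ≠ 0`, because `L` has finitely many eigenvalues
  (`C1SelfMap.exists_path_hasRegularPointIn`). The perturbations are jointly `C^1` in `t` and the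
  point near `t = 0`, and are supported in a fixed compact set, so they converge to `F` as `t` tends
  to `0`, even in the strong topology (`C1SelfMap.tendsto_strongTopology`).
-/

open Filter

/-! ### Transitive sets of maps whose images of open sets have interior -/

theorem nonempty_interior_iterate_image {X : Type*} [TopologicalSpace X] {f : X → X}
    (hf : ∀ W : Set X, IsOpen W → W.Nonempty → (interior (f '' W)).Nonempty) (n : ℕ) {W : Set X}
    (hW : IsOpen W) (hne : W.Nonempty) : (interior (f^[n] '' W)).Nonempty := by
  induction n with
  | zero => simpa [hW.interior_eq] using hne
  | succ n ih =>
    refine (hf _ isOpen_interior ih).mono (interior_mono ?_)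
    rw [Function.iterate_succ', Set.image_comp]
    exact Set.image_mono interior_subset

/-- By transitivity, orbits starting in the interior of `A` come arbitrarily close to every point of
`A`; they carry along a small open set, whose image has interior and stays in `A`. -/
theorem transitiveSetsAreRegularClosed_of_interior_image {X : Type*} [TopologicalSpace X]
    {f : X → X} (hcont : Continuous f)
    (hf : ∀ W : Set X, IsOpen W → W.Nonempty → (interior (f '' W)).Nonempty) :
    TransitiveSetsAreRegularClosed f := by
  intro A hA hinv htr hne
  refine Set.Subset.antisymm (fun x hx => ?_) (closure_minimal interior_subset hA)
  rw [mem_closure_iff]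
  intro V hV hxV
  obtain ⟨n, y, ⟨-, hyU⟩, hyV⟩ := htr (interior A) V isOpen_interior hV
    (by rwa [Set.inter_eq_right.2 interior_subset]) ⟨x, hx, hxV⟩
  have hW : IsOpen (interior A ∩ f^[n] ⁻¹' V) :=
    isOpen_interior.inter (hV.preimage (hcont.iterate n))
  obtain ⟨z, hz⟩ := nonempty_interior_iterate_image hf n hW ⟨y, hyU, hyV⟩
  refine ⟨z, ?_, interior_mono ?_ hz⟩
  · obtain ⟨w, hw, rfl⟩ := interior_subset hz
    exact hw.2
  · rintro _ ⟨w, hw, rfl⟩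
    exact hinv.iterate n (interior_subset hw.1)

/-! ### Regular points -/

/-- Adding small nonzero multiples of the identity makes an operator invertible. -/
theorem ContinuousLinearMap.eventually_isUnit_add_smul_one {E : Type*} [NormedAddCommGroup E]
    [NormedSpace ℝ E] [FiniteDimensional ℝ E] (A : E →L[ℝ] E) :
    ∀ᶠ t : ℝ in 𝓝[≠] 0, IsUnit (A + t • (1 : E →L[ℝ] E)) := by
  have hfin : (spectrum ℝ (-A)).Finite := by
    rw [← AlgEquiv.spectrum_eq (Module.End.toContinuousLinearMap E).symm]
    exact Module.End.finite_spectrum _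
  have hnhds : (spectrum ℝ (-A) \ {0})ᶜ ∈ 𝓝 (0 : ℝ) :=
    (hfin.subset Set.sdiff_subset).isClosed.isOpen_compl.mem_nhds (by simp)
  filter_upwards [mem_nhdsWithin_of_mem_nhds hnhds, self_mem_nhdsWithin] with t ht ht0
  have hmem : t ∉ spectrum ℝ (-A) := fun h => ht ⟨h, ht0⟩
  rw [spectrum.notMem_iff, sub_neg_eq_add, Algebra.algebraMap_eq_smul_one, add_comm] at hmem
  exact hmem

namespace C1SelfMap

variable {E : Type*} [NormedAddCommGroup E] [NormedSpace ℝ E]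
  {M : Type*} [TopologicalSpace M] [ChartedSpace E M]

/-- Some point of `B` is a regular point of `F`: the derivative of `F` there, read in a pair of
`C^1` charts, is an invertible endomorphism of `E`. Quantifying over charts rather than using
`mfderiv` matches the way derivatives enter `chartNhd`. -/
def HasRegularPointIn (F : C1SelfMap E M) (B : Set M) : Prop :=
  ∃ x ∈ B, ∃ φ ∈ IsManifold.maximalAtlas 𝓘(ℝ, E) 1 M, ∃ ψ ∈ IsManifold.maximalAtlas 𝓘(ℝ, E) 1 M,
    x ∈ φ.source ∧ F x ∈ ψ.source ∧ IsUnit (fderiv ℝ (fun v => ψ (F (φ.symm v))) (φ x))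

/-- A `C^1` family of self-maps, read in charts, is jointly `C^1` in the parameter and the point. -/
theorem contDiffAt_family_chart {P : ℝ × M → M} {t : ℝ} {x : M}
    (hP : ContMDiffAt (𝓘(ℝ, ℝ).prod 𝓘(ℝ, E)) 𝓘(ℝ, E) 1 P (t, x))
    {φ ψ : OpenPartialHomeomorph M E} (hφ : φ ∈ IsManifold.maximalAtlas 𝓘(ℝ, E) 1 M)
    (hψ : ψ ∈ IsManifold.maximalAtlas 𝓘(ℝ, E) 1 M) (hx : x ∈ φ.source) (hPx : P (t, x) ∈ ψ.source) :
    ContDiffAt ℝ 1 (fun p : ℝ × E => ψ (P (p.1, φ.symm p.2))) (t, φ x) := by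
  have h2 : ContMDiffAt (𝓘(ℝ, ℝ).prod 𝓘(ℝ, E)) 𝓘(ℝ, E) 1 (fun p : ℝ × E => φ.symm p.2)
      (t, φ x) :=
    ContMDiffAt.comp (t, φ x) (contMDiffAt_symm_of_mem_maximalAtlas hφ (φ.map_source hx))
      contMDiffAt_snd
  have h3 : ContMDiffAt (𝓘(ℝ, ℝ).prod 𝓘(ℝ, E)) (𝓘(ℝ, ℝ).prod 𝓘(ℝ, E)) 1
      (fun p : ℝ × E => (p.1, φ.symm p.2)) (t, φ x) := contMDiffAt_fst.prodMk h2
  have h4 : ContMDiffAt (𝓘(ℝ, ℝ).prod 𝓘(ℝ, E)) 𝓘(ℝ, E) 1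
      (fun p : ℝ × E => P (p.1, φ.symm p.2)) (t, φ x) :=
    ContMDiffAt.comp_of_eq hP h3 (by simp [φ.left_inv hx])
  have h5 : ContMDiffAt (𝓘(ℝ, ℝ).prod 𝓘(ℝ, E)) 𝓘(ℝ, E) 1
      (fun p : ℝ × E => ψ (P (p.1, φ.symm p.2))) (t, φ x) :=
    ContMDiffAt.comp_of_eq (contMDiffAt_of_mem_maximalAtlas hψ hPx) h4 (by simp [φ.left_inv hx])
  rw [← contMDiffAt_iff_contDiffAt, modelWithCornersSelf_prod, ← chartedSpaceSelf_prod]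
  exact h5

theorem contDiffAt_chart (F : C1SelfMap E M) {x : M}
    {φ ψ : OpenPartialHomeomorph M E} (hφ : φ ∈ IsManifold.maximalAtlas 𝓘(ℝ, E) 1 M)
    (hψ : ψ ∈ IsManifold.maximalAtlas 𝓘(ℝ, E) 1 M) (hx : x ∈ φ.source) (hFx : F x ∈ ψ.source) :
    ContDiffAt ℝ 1 (fun v => ψ (F (φ.symm v))) (φ x) := by
  rw [← contMDiffAt_iff_contDiffAt]
  have h1 : ContMDiffAt 𝓘(ℝ, E) 𝓘(ℝ, E) 1 (fun v => F (φ.symm v)) (φ x) :=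
    ContMDiffAt.comp _ F.contMDiff.contMDiffAt
      (contMDiffAt_symm_of_mem_maximalAtlas hφ (φ.map_source hx))
  exact ContMDiffAt.comp_of_eq (contMDiffAt_of_mem_maximalAtlas hψ hFx) h1
    (by simp [φ.left_inv hx])

/-- By the inverse function theorem, `F` is locally open at a regular point. -/
theorem HasRegularPointIn.interior_image_nonempty [CompleteSpace E] {F : C1SelfMap E M} {W : Set M}
    (hW : IsOpen W) (h : F.HasRegularPointIn W) : (interior (F '' W)).Nonempty := by
  obtain ⟨x, hxW, φ, hφ, ψ, hψ, hx, hFx, u, hu⟩ := h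
  have hs := (F.contDiffAt_chart hφ hψ hx hFx).hasStrictFDerivAt one_ne_zero
  rw [← hu] at hs
  have hmap := HasStrictFDerivAt.map_nhds_eq_of_equiv
    (f' := ContinuousLinearEquiv.unitsEquiv ℝ E u) hs
  simp only [φ.left_inv hx] at hmap
  have hFmap : map F (𝓝 x) = 𝓝 (F x) := by
    have h1 : (F : M → M) =ᶠ[𝓝 x] ψ.symm ∘ (fun v => ψ (F (φ.symm v))) ∘ φ := by
      filter_upwards [φ.open_source.mem_nhds hx,
        F.contMDiff.continuous.continuousAt.preimage_mem_nhds (ψ.open_source.mem_nhds hFx)]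
        with y hy hFy
      simp [φ.left_inv hy, ψ.left_inv hFy]
    rw [map_congr h1, ← map_map, ← map_map, φ.map_nhds_eq hx, hmap,
      ψ.symm.map_nhds_eq (ψ.map_source hFx), ψ.left_inv hFx]
  exact ⟨F x, mem_interior_iff_mem_nhds.2 (hFmap ▸ image_mem_map (hW.mem_nhds hxW))⟩

/-- Having a regular point in `B` is an open condition: closeness to `F` on the single compact set
`{x}`, where `x` is a regular point of `F`, keeps the derivative at `x` invertible. -/
theorem HasRegularPointIn.exists_chartNhd_subset [CompleteSpace E] {F : C1SelfMap E M} {B : Set M}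
    (h : F.HasRegularPointIn B) : ∃ φ ψ K ε, IsAdapted F φ ψ K ε ∧
      chartNhd F φ ψ K ε ⊆ {G | G.HasRegularPointIn B} := by
  obtain ⟨x, hxB, φ, hφ, ψ, hψ, hx, hFx, hu⟩ := h
  obtain ⟨ε, hε, hball⟩ := Metric.isOpen_iff.1 Units.isOpen _ hu
  refine ⟨φ, ψ, {x}, ε, ⟨hφ, hψ, isCompact_singleton, by simpa, by simpa, hε⟩, fun G hG => ?_⟩
  obtain ⟨hGx, hG⟩ := hG
  refine ⟨x, hxB, φ, hφ, ψ, hψ, hx, hGx rfl, hball ?_⟩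
  rw [mem_ball_iff_norm]
  exact (hG x rfl).2

/-! ### Continuity of paths in the weak and strong topologies -/

theorem mem_chartNhd_self {F : C1SelfMap E M} {φ ψ K ε} (h : IsAdapted F φ ψ K ε) :
    F ∈ chartNhd F φ ψ K ε :=
  ⟨h.mapsTo, fun x _ => by simpa using h.pos⟩

theorem chartNhd_congr {f F G : C1SelfMap E M} {φ ψ K ε} (h : IsAdapted f φ ψ K ε)
    (hFG : ∀ x ∈ K, G =ᶠ[𝓝 x] F) (hF : F ∈ chartNhd f φ ψ K ε) : G ∈ chartNhd f φ ψ K ε := by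
  refine ⟨fun x hx => ?_, fun x hx => ?_⟩
  · rw [(hFG x hx).eq_of_nhds]
    exact hF.1 hx
  · have hx' := h.subset_source hx
    have h1 : (fun v => ψ (G (φ.symm v))) =ᶠ[𝓝 (φ x)] fun v => ψ (F (φ.symm v)) := by
      have := (φ.tendsto_symm hx').eventually (hFG x hx)
      filter_upwards [this] with v hv
      rw [hv]
    rw [(hFG x hx).eq_of_nhds, h1.fderiv_eq]
    exact hF.2 x hx

/-- The conditions defining `chartNhd` are open in `(t, x)` along a `C^1` family, so by compactness
of `K` they persist on all of `K` for small `t`. -/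
theorem eventually_mem_chartNhd {G : ℝ → C1SelfMap E M}
    (hG : ∀ x, ContMDiffAt (𝓘(ℝ, ℝ).prod 𝓘(ℝ, E)) 𝓘(ℝ, E) 1 (fun p : ℝ × M => G p.1 p.2) (0, x))
    {f : C1SelfMap E M} {φ ψ K ε} (h : IsAdapted f φ ψ K ε) (h0 : G 0 ∈ chartNhd f φ ψ K ε) :
    ∀ᶠ t in 𝓝 0, G t ∈ chartNhd f φ ψ K ε := by
  have key : ∀ x ∈ K, ∀ᶠ p : ℝ × M in 𝓝 (0, x), G p.1 p.2 ∈ ψ.source ∧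
      ‖ψ (G p.1 p.2) - ψ (f p.2)‖ < ε ∧
      ‖fderiv ℝ (fun v => ψ (G p.1 (φ.symm v))) (φ p.2) -
        fderiv ℝ (fun v => ψ (f (φ.symm v))) (φ p.2)‖ < ε := by
    intro x hxK
    have hx := h.subset_source hxK
    have hφx : ContinuousAt (fun p : ℝ × M => φ p.2) (0, x) :=
      ContinuousAt.comp_of_eq (φ.continuousAt hx) continuousAt_snd rfl
    have hGc : ContinuousAt (fun p : ℝ × M => G p.1 p.2) (0, x) := (hG x).continuousAt
    have hfc : ContinuousAt (fun p : ℝ × M => f p.2) (0, x) :=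
      (f.contMDiff.continuous.comp continuous_snd).continuousAt
    have hψG : ContinuousAt (fun p : ℝ × M => ψ (G p.1 p.2)) (0, x) :=
      ContinuousAt.comp_of_eq (ψ.continuousAt (h0.1 hxK)) hGc rfl
    have hψf : ContinuousAt (fun p : ℝ × M => ψ (f p.2)) (0, x) :=
      ContinuousAt.comp_of_eq (ψ.continuousAt (h.mapsTo hxK)) hfc rfl
    have hdf : ContinuousAt
        (fun p : ℝ × M => fderiv ℝ (fun v => ψ (f (φ.symm v))) (φ p.2)) (0, x) := by
      have := ((f.contDiffAt_chart h.source_chart h.target_chart hx (h.mapsTo hxK)).fderiv_right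
        (m := 0) le_rfl).continuousAt
      exact ContinuousAt.comp_of_eq this hφx rfl
    have hdG : ContinuousAt
        (fun p : ℝ × M => fderiv ℝ (fun v => ψ (G p.1 (φ.symm v))) (φ p.2)) (0, x) := by
      have h1 := contDiffAt_family_chart (hG x) h.source_chart h.target_chart hx (h0.1 hxK)
      have h2 : ContDiffAt ℝ 0
          (fun p : ℝ × E => fderiv ℝ (fun v => ψ (G p.1 (φ.symm v))) p.2) (0, φ x) := by
        refine ContDiffAt.fderiv (f := fun (p : ℝ × E) v => ψ (G p.1 (φ.symm v)))
          (g := fun p : ℝ × E => p.2) (n := 1) ?_ contDiffAt_snd le_rfl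
        exact ContDiffAt.comp (f := fun q : (ℝ × E) × E => (q.1.1, q.2)) ((0, φ x), φ x) h1
          (by fun_prop)
      exact ContinuousAt.comp_of_eq (f := fun p : ℝ × M => (p.1, φ p.2)) h2.continuousAt
        (continuousAt_fst.prodMk hφx) rfl
    refine (hGc.eventually (ψ.open_source.mem_nhds (h0.1 hxK))).and
      (Eventually.and ?_ ?_)
    · exact (hψG.sub hψf).norm.eventually_lt continuousAt_const (h0.2 x hxK).1
    · exact (hdG.sub hdf).norm.eventually_lt continuousAt_const (h0.2 x hxK).2
  filter_upwards [h.isCompact.eventually_forall_of_forall_eventually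
    (P := fun t x => G t x ∈ ψ.source ∧ ‖ψ (G t x) - ψ (f x)‖ < ε ∧
      ‖fderiv ℝ (fun v => ψ (G t (φ.symm v))) (φ x) -
        fderiv ℝ (fun v => ψ (f (φ.symm v))) (φ x)‖ < ε) key] with t ht
  exact ⟨fun x hx => (ht x hx).1, fun x hx => (ht x hx).2⟩

theorem tendsto_weakTopology {G : ℝ → C1SelfMap E M}
    (hG : ∀ x, ContMDiffAt (𝓘(ℝ, ℝ).prod 𝓘(ℝ, E)) 𝓘(ℝ, E) 1 (fun p : ℝ × M => G p.1 p.2) (0, x)) :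
    Tendsto G (𝓝 0) (@nhds _ (weakTopology E M) (G 0)) := by
  rw [TopologicalSpace.tendsto_nhds_generateFrom_iff]
  rintro _ ⟨f, φ, ψ, K, ε, h, rfl⟩ h0
  exact eventually_mem_chartNhd hG h h0

/-- In the strong topology the path must in addition be constant off a compact set `C`: only
finitely many members of a locally finite family of charts meet `C`, and the others impose no
condition on the perturbation. -/
theorem tendsto_strongTopology [T2Space M] {G : ℝ → C1SelfMap E M}
    (hG : ∀ x, ContMDiffAt (𝓘(ℝ, ℝ).prod 𝓘(ℝ, E)) 𝓘(ℝ, E) 1 (fun p : ℝ × M => G p.1 p.2) (0, x))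
    {C : Set M} (hC : IsCompact C) (hGC : ∀ t, ∀ x ∉ C, G t x = G 0 x) :
    Tendsto G (𝓝 0) (@nhds _ (strongTopology E M) (G 0)) := by
  rw [TopologicalSpace.tendsto_nhds_generateFrom_iff]
  rintro _ ⟨f, ι, φ, ψ, K, ε, hlf, h, rfl⟩ h0
  rw [Set.mem_iInter] at h0
  have hfin := hlf.finite_nonempty_inter_compact hC
  have hev := (hfin.eventually_all (l := 𝓝 (0 : ℝ))
    (p := fun i t => G t ∈ chartNhd f (φ i) (ψ i) (K i) (ε i))).2
    fun i _ => eventually_mem_chartNhd hG (h i) (h0 i)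
  filter_upwards [hev] with t ht
  simp only [Set.mem_preimage, Set.mem_iInter]
  intro i
  by_cases hi : ((φ i).source ∩ C).Nonempty
  · exact ht i hi
  · refine chartNhd_congr (h i) (fun x hx => ?_) (h0 i)
    have hxC : x ∉ C := fun hxC => hi ⟨x, (h i).subset_source hx, hxC⟩
    filter_upwards [hC.isClosed.isOpen_compl.mem_nhds hxC] with y hy using hGC t y hy

/-! ### Making a given point regular -/

/-- In charts at `x₀` and `F x₀`, add to `F` the vector field `t • (v - v₀)`, cut off near
`v₀ = φ x₀`. This gives a path through `F`, jointly `C^1` at parameter `0`, constant off a compact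
set, whose derivative at `x₀` is that of `F` plus `t` times the identity. -/
theorem exists_perturbation [FiniteDimensional ℝ E] [T2Space M] [IsManifold 𝓘(ℝ, E) 1 M]
    (F : C1SelfMap E M) (x₀ : M) :
    ∃ (G : ℝ → C1SelfMap E M) (C : Set M), G 0 = F ∧ IsCompact C ∧
      (∀ t, ∀ x ∉ C, G t x = F x) ∧
      (∀ x, ContMDiffAt (𝓘(ℝ, ℝ).prod 𝓘(ℝ, E)) 𝓘(ℝ, E) 1 (fun p : ℝ × M => G p.1 p.2) (0, x)) ∧
      ∀ᶠ t in 𝓝 0, G t x₀ = F x₀ ∧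
        (fun v => chartAt E (F x₀) (G t ((chartAt E x₀).symm v))) =ᶠ[𝓝 (chartAt E x₀ x₀)]
        fun v => chartAt E (F x₀) (F ((chartAt E x₀).symm v)) + t • (v - chartAt E x₀ x₀) := by
  classical
  set φ := chartAt E x₀
  set ψ := chartAt E (F x₀)
  have hφ : φ ∈ IsManifold.maximalAtlas 𝓘(ℝ, E) 1 M := IsManifold.chart_mem_maximalAtlas x₀
  have hψ : ψ ∈ IsManifold.maximalAtlas 𝓘(ℝ, E) 1 M := IsManifold.chart_mem_maximalAtlas (F x₀)
  have hx₀ : x₀ ∈ φ.source := mem_chart_source E x₀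
  have hFx₀ : F x₀ ∈ ψ.source := mem_chart_source E (F x₀)
  have hFc : Continuous F := F.contMDiff.continuous
  set v₀ := φ x₀ with hv₀
  have hD : φ.target ∩ φ.symm ⁻¹' (F ⁻¹' ψ.source) ∈ 𝓝 v₀ := by
    refine inter_mem (φ.open_target.mem_nhds (φ.map_source hx₀)) ?_
    refine φ.tendsto_symm hx₀ ?_
    exact (ψ.open_source.preimage hFc).mem_nhds hFx₀
  obtain ⟨r, hr, hball⟩ := Metric.nhds_basis_closedBall.mem_iff.1 hD
  let χ : ContDiffBump v₀ := ⟨r / 2, r, half_pos hr, half_lt_self hr⟩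
  set h : E → E := fun v => χ v • (v - v₀) with hh
  have hsmooth : ContDiff ℝ 1 h := χ.contDiff.smul (contDiff_id.sub contDiff_const)
  have hzero : ∀ v ∉ Metric.closedBall v₀ r, h v = 0 := by
    intro v hv
    have : χ v = 0 := χ.zero_of_le_dist (le_of_lt (by simpa using hv))
    simp [hh, this]
  have hone : h =ᶠ[𝓝 v₀] fun v => v - v₀ := by
    filter_upwards [χ.eventuallyEq_one] with v hv
    simp [hh, hv]
  set D := Metric.closedBall v₀ r 
  have hDc : IsCompact D := isCompact_closedBall v₀ r
  set C := φ.symm '' D 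
  have hCc : IsCompact C :=
    hDc.image_of_continuousOn (φ.continuousOn_symm.mono fun v hv => (hball hv).1)
  have hCφ : ∀ x ∈ C, x ∈ φ.source ∧ F x ∈ ψ.source := by
    rintro _ ⟨v, hv, rfl⟩
    exact ⟨φ.map_target (hball hv).1, (hball hv).2⟩
  have hhC : ∀ x ∈ φ.source, x ∉ C → h (φ x) = 0 := fun x hx hxC =>
    hzero _ fun hxD => hxC ⟨φ x, hxD, φ.left_inv hx⟩
  have hloc : ∀ x ∈ φ.source, F x ∈ ψ.source →
      ContMDiffAt 𝓘(ℝ, E) 𝓘(ℝ, E) 1 (fun y => ψ (F y)) x ∧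
      ContMDiffAt 𝓘(ℝ, E) 𝓘(ℝ, E) 1 (fun y => h (φ y)) x := fun x hx hFx =>
    ⟨ContMDiffAt.comp_of_eq (contMDiffAt_of_mem_maximalAtlas hψ hFx) F.contMDiff.contMDiffAt rfl,
      hsmooth.contMDiff.contMDiffAt.comp x (contMDiffAt_of_mem_maximalAtlas hφ hx)⟩
  let q : ℝ → M → E := fun t x => ψ (F x) + t • h (φ x)
  have hq : ∀ t, ∀ x ∈ φ.source, F x ∈ ψ.source →
      ContMDiffAt (𝓘(ℝ, ℝ).prod 𝓘(ℝ, E)) 𝓘(ℝ, E) 1 (fun p : ℝ × M => q p.1 p.2) (t, x) := by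
    intro t x hx hFx
    obtain ⟨h1, h2⟩ := hloc x hx hFx
    have h1' := ContMDiffAt.comp_of_eq (x := (t, x)) h1
      (contMDiffAt_snd (I := 𝓘(ℝ, ℝ)) (n := 1)) rfl
    have h2' := ContMDiffAt.comp_of_eq (x := (t, x)) h2
      (contMDiffAt_snd (I := 𝓘(ℝ, ℝ)) (n := 1)) rfl
    exact h1'.add (contMDiffAt_fst.smul h2')
  -- On the chart domain the two branches agree off `C`, where `h ∘ φ` vanishes (`hP`).
  let P : ℝ × M → M := fun p => if p.2 ∈ C then ψ.symm (q p.1 p.2) else F p.2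
  have hP : ∀ t, ∀ x ∈ φ.source, F x ∈ ψ.source → P (t, x) = ψ.symm (q t x) := by
    intro t x hx hFx
    by_cases hxC : x ∈ C
    · simp [P, hxC]
    · simp [P, hxC, q, hhC x hx hxC, ψ.left_inv hFx]
  -- The parameters for which the perturbed values stay in the image of the chart `ψ`, so that
  -- `ψ.symm` is meaningful there; for the other parameters the path is set to `F`.
  let S : Set ℝ := {t | ∀ x ∈ C, q t x ∈ ψ.target}
  have hS : S ∈ 𝓝 0 := by
    refine hCc.eventually_forall_of_forall_eventually (P := fun t x => q t x ∈ ψ.target)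
      fun x hxC => ?_
    obtain ⟨hx, hFx⟩ := hCφ x hxC
    refine (hq 0 x hx hFx).continuousAt.eventually (ψ.open_target.mem_nhds ?_)
    simpa [q] using ψ.map_source hFx
  have hSsm : ∀ t ∈ S, ∀ x,
      ContMDiffAt (𝓘(ℝ, ℝ).prod 𝓘(ℝ, E)) 𝓘(ℝ, E) 1 P (t, x) := by
    intro t ht x
    by_cases hxC : x ∈ C
    · obtain ⟨hx, hFx⟩ := hCφ x hxC
      refine (ContMDiffAt.comp_of_eq (contMDiffAt_symm_of_mem_maximalAtlas hψ (ht x hxC))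
        (hq t x hx hFx) rfl).congr_of_eventuallyEq ?_
      filter_upwards [continuousAt_snd.preimage_mem_nhds (x := (t, x)) (φ.open_source.mem_nhds hx),
        continuousAt_snd.preimage_mem_nhds (x := (t, x))
          ((ψ.open_source.preimage hFc).mem_nhds hFx)] with p hp hFp
      exact hP p.1 p.2 hp hFp
    · refine (ContMDiffAt.comp_of_eq (x := (t, x)) (F.contMDiff.contMDiffAt (x := x))
        (contMDiffAt_snd (I := 𝓘(ℝ, ℝ)) (n := 1)) rfl).congr_of_eventuallyEq ?_
      filter_upwards [continuousAt_snd.preimage_mem_nhds (x := (t, x))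
        (hCc.isClosed.isOpen_compl.mem_nhds hxC)] with p hp
      exact if_neg hp
  have h0S : (0 : ℝ) ∈ S := mem_of_mem_nhds hS
  have hPt : ∀ t ∈ S, ContMDiff 𝓘(ℝ, E) 𝓘(ℝ, E) 1 fun x => P (t, x) := fun t ht x =>
    ContMDiffAt.comp_of_eq (hSsm t ht x) (contMDiffAt_const.prodMk contMDiffAt_id) rfl
  let G : ℝ → C1SelfMap E M := fun t => if ht : t ∈ S then ⟨fun x => P (t, x), hPt t ht⟩ else F
  have hG : ∀ t ∈ S, ∀ x, G t x = P (t, x) := by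
    intro t ht x
    have h1 : G t = ⟨fun x => P (t, x), hPt t ht⟩ := dif_pos ht
    rw [h1]
    rfl
  refine ⟨G, C, ?_, hCc, ?_, fun x => ?_, ?_⟩
  · ext x
    rw [hG 0 h0S]
    by_cases hxC : x ∈ C
    · simp [P, q, hxC, ψ.left_inv (hCφ x hxC).2]
    · simp [P, hxC]
  · intro t x hxC
    by_cases ht : t ∈ S
    · rw [hG t ht]
      exact if_neg hxC
    · rw [show G t = F from dif_neg ht]
  · refine (hSsm 0 h0S x).congr_of_eventuallyEq ?_
    filter_upwards [continuousAt_fst.preimage_mem_nhds (x := ((0 : ℝ), x)) hS] with p hp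
    exact hG p.1 hp p.2
  · filter_upwards [hS] with t ht
    refine ⟨?_, ?_⟩
    · rw [hG t ht, hP t x₀ hx₀ hFx₀]
      simp [q, ← hv₀, hone.eq_of_nhds, ψ.left_inv hFx₀]
    · filter_upwards [Metric.closedBall_mem_nhds v₀ hr, hone] with v hv hhv
      obtain ⟨hvt, hvF⟩ := hball hv
      have hvC : φ.symm v ∈ C := ⟨v, hv, rfl⟩
      rw [hG t ht, hP t _ (φ.map_target hvt) hvF, ψ.right_inv (ht _ hvC)]
      simp only [q, φ.right_inv hvt, hhv]

theorem exists_path_hasRegularPointIn [FiniteDimensional ℝ E] [T2Space M]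
    [IsManifold 𝓘(ℝ, E) 1 M] (F : C1SelfMap E M) {B : Set M} (hB : B.Nonempty) :
    ∃ (G : ℝ → C1SelfMap E M) (C : Set M), G 0 = F ∧ IsCompact C ∧
      (∀ t, ∀ x ∉ C, G t x = G 0 x) ∧
      (∀ x, ContMDiffAt (𝓘(ℝ, ℝ).prod 𝓘(ℝ, E)) 𝓘(ℝ, E) 1 (fun p : ℝ × M => G p.1 p.2) (0, x)) ∧
      ∀ᶠ t in 𝓝[≠] 0, (G t).HasRegularPointIn B := by
  obtain ⟨x₀, hx₀⟩ := hB
  obtain ⟨G, C, hG0, hC, hGC, hsm, hev⟩ := F.exists_perturbation x₀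
  refine ⟨G, C, hG0, hC, by simpa [hG0] using hGC, hsm, ?_⟩
  have hφ := IsManifold.chart_mem_maximalAtlas (I := 𝓘(ℝ, E)) (n := 1) x₀
  have hψ := IsManifold.chart_mem_maximalAtlas (I := 𝓘(ℝ, E)) (n := 1) (F x₀)
  have hdiff := (F.contDiffAt_chart hφ hψ (mem_chart_source E x₀)
    (mem_chart_source E (F x₀))).differentiableAt one_ne_zero
  filter_upwards [mem_nhdsWithin_of_mem_nhds hev,
    ContinuousLinearMap.eventually_isUnit_add_smul_one
      (fderiv ℝ (fun v => chartAt E (F x₀) (F ((chartAt E x₀).symm v))) (chartAt E x₀ x₀))]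
    with t ht hu
  refine ⟨x₀, hx₀, _, hφ, _, hψ, mem_chart_source E x₀, ?_, ?_⟩
  · rw [ht.1]
    exact mem_chart_source E (F x₀)
  · have hid : HasFDerivAt (fun v : E => t • (v - chartAt E x₀ x₀)) (t • (1 : E →L[ℝ] E))
        (chartAt E x₀ x₀) := ((hasFDerivAt_id _).sub_const _).const_smul t
    rw [ht.2.fderiv_eq, (hdiff.hasFDerivAt.fun_add hid).fderiv]
    exact hu

/-! ### Genericity -/

/-- The property is implied by the countably many conditions of having a regular point in each
member of a countable base of `M`. -/
theorem eventually_residual_transitiveSetsAreRegularClosed [FiniteDimensional ℝ E]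
    [SecondCountableTopology M] [TopologicalSpace (C1SelfMap E M)]
    (hopen : ∀ (f : C1SelfMap E M) φ ψ K ε, IsAdapted f φ ψ K ε → IsOpen (chartNhd f φ ψ K ε))
    (hdense : ∀ B : Set M, IsOpen B → B.Nonempty →
      Dense {F : C1SelfMap E M | F.HasRegularPointIn B}) :
    ∀ᶠ F : C1SelfMap E M in residual (C1SelfMap E M),
      TransitiveSetsAreRegularClosed (F : M → M) := by
  have hb := TopologicalSpace.isBasis_countableBasis M
  have hres : ∀ B ∈ TopologicalSpace.countableBasis M,
      ∀ᶠ F : C1SelfMap E M in residual (C1SelfMap E M), F.HasRegularPointIn B := by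
    intro B hB
    refine residual_of_dense_open ?_ (hdense B (hb.isOpen hB)
      (TopologicalSpace.nonempty_of_mem_countableBasis hB))
    refine isOpen_iff_mem_nhds.2 fun F hF => ?_
    obtain ⟨φ, ψ, K, ε, had, hsub⟩ := HasRegularPointIn.exists_chartNhd_subset hF
    exact mem_of_superset ((hopen F φ ψ K ε had).mem_nhds (mem_chartNhd_self had)) hsub
  have hall := (eventually_countable_ball (TopologicalSpace.countable_countableBasis M)).2 hres
  filter_upwards [hall] with F hF
  refine transitiveSetsAreRegularClosed_of_interior_image F.contMDiff.continuous
    fun W hW hne => ?_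
  obtain ⟨x, hx⟩ := hne
  obtain ⟨B, hB, -, hBW⟩ := hb.exists_subset_of_mem_open hx hW
  exact (HasRegularPointIn.interior_image_nonempty (hb.isOpen hB) (hF B hB)).mono
    (interior_mono (Set.image_mono hBW))

end C1SelfMap

theorem mainTheorem3 {E : Type*} [NormedAddCommGroup E] [NormedSpace ℝ E] [FiniteDimensional ℝ E]
    {M : Type*} [TopologicalSpace M] [T2Space M] [SecondCountableTopology M]
    [ChartedSpace E M] [IsManifold 𝓘(ℝ, E) 1 M] :
    (∀ᶠ F : C1SelfMap E M in @residual (C1SelfMap E M) (C1SelfMap.weakTopology E M),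
      TransitiveSetsAreRegularClosed (F : M → M)) ∧
    (∀ᶠ F : C1SelfMap E M in @residual (C1SelfMap E M) (C1SelfMap.strongTopology E M),
      TransitiveSetsAreRegularClosed (F : M → M)) := by
  constructor
  · let := C1SelfMap.weakTopology E M
    refine C1SelfMap.eventually_residual_transitiveSetsAreRegularClosed
      (fun f φ ψ K ε h => .basic _ ⟨f, φ, ψ, K, ε, h, rfl⟩) fun B _ hB F => ?_
    obtain ⟨G, C, rfl, -, -, hsm, hreg⟩ := F.exists_path_hasRegularPointIn hB
    exact mem_closure_of_tendsto
      ((C1SelfMap.tendsto_weakTopology hsm).mono_left nhdsWithin_le_nhds) hreg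
  · let := C1SelfMap.strongTopology E M
    refine C1SelfMap.eventually_residual_transitiveSetsAreRegularClosed
      (fun f φ ψ K ε h => ?_) fun B _ hB F => ?_
    · exact .basic _ ⟨f, Unit, fun _ => φ, fun _ => ψ, fun _ => K, fun _ => ε,
        locallyFinite_of_finite _, fun _ => h, (Set.iInter_const _).symm⟩
    · obtain ⟨G, C, rfl, hC, hGC, hsm, hreg⟩ := F.exists_path_hasRegularPointIn hB
      exact mem_closure_of_tendsto
        ((C1SelfMap.tendsto_strongTopology hsm hC hGC).mono_left nhdsWithin_le_nhds) hreg
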